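/- Let $K$ be a number field, $p$ a prime number, $n\ge 1$ and $r\geq 1$ integers, and let $\mathfrak q$ be a tame prime of $K$, i.e. a nonzero prime ideal of $\mathcal O_K$ with $\mathfrak q\nmid p$. Let $K_{\mathfrak q}$ be the completion of $K$ at $\mathfrak q$, let $\Gamma_{\mathfrak q}$ be its absolute pro-$p$ Galois group (the Galois group over $K_{\mathfrak q}$ of the compositum of all finite Galois extensions of $K_{\mathfrak q}$ of $p$-power degree), and let $N(\mathfrak q)=\#(\mathcal O_K/\mathfrak q)$. For a commutative ring $R$ let $U_{n+1}(R)$ be the group of upper-triangular unipotent $(n+1)\times(n+1)$ matrices over $R$. Let $\rho_{\mathfrak q}:\Gamma_{\mathfrak q}\to U_{n+1}(\mathbb F_p)$ be a continuous homomorphism, and suppose that $\rho_{\mathfrak q}$ has a lift to $U_{n+1}(\mathbb Z/p^r)$, i.e. a continuous homomorphism $\rho_{\mathfrak q,r}:\Gamma_{\mathfrak q}\to U_{n+1}(\mathbb Z/p^r)$ whose reduction modulo $p$ is $\rho_{\mathfrak q}$. For $1\le i\le n$ let $\theta_i:\Gamma_{\mathfrak q}\to\mathbb F_p$ be the character given by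 the $(i,i+1)$-entry of $\rho_{\mathfrak q}$. If for some $i$ the character $\theta_i$ is ramified, i.e. nontrivial on the inertia subgroup of $\Gamma_{\mathfrak q}$, then $K_{\mathfrak q}$ contains a primitive $p^r$-th root of unity, and $N(\mathfrak q)\equiv 1 \pmod{p^r}$. -/

import Mathlib

open IsDedekindDomain NumberField

noncomputable section

namespace LocalLift

/-- The group `U_m(R)` of upper-triangular unipotent `m × m` matrices over `R`, as a subgroup of
`GL_m(R)`. -/
def unipotent (m : ℕ) (R : Type*) [CommRing R] : Subgroup (Matrix.GeneralLinearGroup (Fin m) R) where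
  carrier := {g | (∀ i j, j < i → (g : Matrix (Fin m) (Fin m) R) i j = 0) ∧
    ∀ i, (g : Matrix (Fin m) (Fin m) R) i i = 1}
  one_mem' := by
    refine ⟨fun i j h => ?_, fun i => ?_⟩
    · simp [h.ne']
    · simp
  mul_mem' := by
    rintro a b ⟨ha, ha'⟩ ⟨hb, hb'⟩
    refine ⟨fun i j h => ?_, fun i => ?_⟩
    · rw [Units.val_mul, Matrix.mul_apply]
      refine Finset.sum_eq_zero fun k _ => ?_
      rcases lt_or_ge k i with hk | hk
      · rw [ha i k hk, zero_mul]
      · rw [hb k j (h.trans_le hk), mul_zero]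
    · rw [Units.val_mul, Matrix.mul_apply, Finset.sum_eq_single i]
      · rw [ha', hb', one_mul]
      · intro k _ hk
        rcases lt_or_gt_of_ne hk with hk | hk
        · rw [ha i k hk, zero_mul]
        · rw [hb k i hk, mul_zero]
      · simp
  inv_mem' := by
    rintro a ⟨ha, ha'⟩
    have htri : Matrix.BlockTriangular (a : Matrix (Fin m) (Fin m) R) id := fun i j h => ha i j h
    let _ : Invertible (a : Matrix (Fin m) (Fin m) R) := a.invertible
    have hinv : ∀ i j, j < i → ((a⁻¹ : Matrix.GeneralLinearGroup (Fin m) R) :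
        Matrix (Fin m) (Fin m) R) i j = 0 := by
      intro i j h
      have := Matrix.blockTriangular_inv_of_blockTriangular htri
      rw [← Matrix.coe_units_inv] at this
      exact this h
    refine ⟨hinv, fun i => ?_⟩
    have h1 : ((a * a⁻¹ : Matrix.GeneralLinearGroup (Fin m) R) :
        Matrix (Fin m) (Fin m) R) i i = 1 := by
      simp
    rw [Units.val_mul, Matrix.mul_apply, Finset.sum_eq_single i] at h1
    · rwa [ha', one_mul] at h1
    · intro k _ hk
      rcases lt_or_gt_of_ne hk with hk | hk
      · rw [ha i k hk, zero_mul]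
      · rw [hinv k i hk, mul_zero]
    · simp

/-- The homomorphism `U_m(R) → U_m(S)` applying the ring homomorphism `f` to every entry. -/
def unipotentMap (m : ℕ) {R S : Type*} [CommRing R] [CommRing S] (f : R →+* S) :
    unipotent m R →* unipotent m S :=
  ((Matrix.GeneralLinearGroup.map (n := Fin m) f).comp (unipotent m R).subtype).codRestrict
    (unipotent m S) (by
      rintro ⟨g, hg, hg'⟩
      refine ⟨fun i j h => ?_, fun i => ?_⟩
      · simp [hg i j h]
      · simp [hg' i])

/-- The `i`-th near-diagonal coordinate `g ↦ g_{i,i+1}` (for `i = 1, …, n`, here indexed from `0`),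
as a homomorphism from `U_{n+1}(R)` to the additive group of `R`. -/
def nearDiagonal (n : ℕ) (R : Type*) [CommRing R] (i : Fin n) :
    unipotent (n + 1) R →* Multiplicative R where
  toFun g := Multiplicative.ofAdd
    (((g : Matrix.GeneralLinearGroup (Fin (n + 1)) R) : Matrix (Fin (n + 1)) (Fin (n + 1)) R)
      i.castSucc i.succ)
  map_one' := by
    simp [(Fin.castSucc_lt_succ (i := i)).ne]
  map_mul' := by
    rintro ⟨a, ha, ha'⟩ ⟨b, hb, hb'⟩
    rw [← ofAdd_add]
    congr 1
    simp only [Subgroup.coe_mul, Units.val_mul, Matrix.mul_apply]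
    have hlt : i.castSucc < i.succ := Fin.castSucc_lt_succ
    rw [Finset.sum_eq_add i.castSucc i.succ hlt.ne]
    · rw [ha', hb', one_mul, mul_one, add_comm]
    · rintro k - ⟨hk1, hk2⟩
      rcases lt_or_gt_of_ne hk1 with hk | hk
      · rw [ha _ k hk, zero_mul]
      · have : i.succ < k := by
          refine lt_of_le_of_ne ?_ (Ne.symm hk2)
          simpa [Fin.le_def, Fin.lt_def] using hk
        rw [hb k _ this, mul_zero]
    · simp
    · simp

/-- The maximal pro-`p` extension of a field `k` inside an algebraic closure: the compositum of all
finite Galois extensions of `k` whose Galois group is a `p`-group. -/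
def maximalProP (p : ℕ) (k : Type*) [Field k] : IntermediateField k (AlgebraicClosure k) :=
  sSup {L | FiniteDimensional k L ∧ IsGalois k L ∧ IsPGroup p (L ≃ₐ[k] L)}

/-- The absolute pro-`p` Galois group of `k`, with its Krull topology. -/
abbrev ProPGaloisGroup (p : ℕ) (k : Type*) [Field k] : Type _ :=
  maximalProP p k ≃ₐ[k] maximalProP p k

/-- The inertia subgroup of `Gal(L/k)`, where `k` is complete with respect to a discrete valuation
with valuation ring `A`, and `L/k` is algebraic: the automorphisms acting trivially on the integral
closure of `A` in `L` modulo its maximal ideal. This integral closure is a local ring, as the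
valuation of `k` extends uniquely to `L`, so its maximal ideal is its Jacobson radical. -/
def inertia {k : Type*} [Field k] (A : ValuationSubring k) (L : Type*) [Field L] [Algebra k L] :
    Subgroup (L ≃ₐ[k] L) :=
  (Ring.jacobson (integralClosure A L)).toAddSubgroup.inertia (L ≃ₐ[k] L)

/-- For a prime `q` of the number field `K`, the group `Γ_q`: the absolute pro-`p` Galois group of
the completion `K_q`. -/
abbrev LocalGaloisGroup (p : ℕ) (K : Type*) [Field K] [NumberField K]
    (q : HeightOneSpectrum (𝓞 K)) : Type _ :=
  ProPGaloisGroup p (q.adicCompletion K)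

/-- A homomorphism from `Γ_q` to a group is ramified if it is nontrivial on the inertia subgroup. -/
def IsRamified {p : ℕ} {K : Type*} [Field K] [NumberField K] {q : HeightOneSpectrum (𝓞 K)}
    {H : Type*} [Group H] (χ : LocalGaloisGroup p K q →* H) : Prop :=
  ∃ τ ∈ inertia (q.adicCompletionIntegers K) (maximalProP p (q.adicCompletion K)), χ τ ≠ 1

end LocalLift

end

/-! Since r ≥ 1, the (i,i+1)-entry of the lift is a continuous character χ to ℤ/p^r reducing to θ_i.
An inertia element τ with θ_i(τ) ≠ 0 has χ(τ) a unit, so τ generates the Galois group modulo ker χ: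
the fixed field of ker χ is cyclic of degree p^r, totally and tamely ramified. Kummer theory on
residues then yields the root of unity. In place of a uniformizer, take y in that field, moved by
τ^(p^s), r = s + 1, by its full norm. As τ is trivial on residues, τ^j y / y ≡ (τ y / y)^j, so τ y /
y has exact order p^r in the residue field (`exists_fixed_residue_root_of_unity`). Averaging puts
this residue in the base field, and `exists_pow_eq_one_norm_sub_lt` lifts it to a root of unity. The
congruence is Lagrange's theorem in the residue field. -/

namespace LocalLift

/-! ### Congruences in an ultrametric field -/

section Ultrametric

variable {M : Type*} [NormedField M] [IsUltrametricDist M]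

theorem norm_sub_lt_of_norm_sub_lt {x y z : M} {C : ℝ} (h₁ : ‖x - y‖ < C) (h₂ : ‖y - z‖ < C) :
    ‖x - z‖ < C := by
  rw [← sub_add_sub_cancel x y z]
  exact (IsUltrametricDist.norm_add_le_max _ _).trans_lt (max_lt h₁ h₂)

theorem norm_pow_sub_pow_lt_one {x y : M} (hx : ‖x‖ ≤ 1) (hy : ‖y‖ ≤ 1) (h : ‖x - y‖ < 1) (m : ℕ) :
    ‖x ^ m - y ^ m‖ < 1 := by
  induction m with
  | zero => simp
  | succ m ih =>
    refine norm_sub_lt_of_norm_sub_lt (y := x ^ m * y) ?_ ?_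
    · rw [pow_succ, ← mul_sub, norm_mul, norm_pow]
      exact (mul_le_of_le_one_left (norm_nonneg _) (pow_le_one₀ (norm_nonneg _) hx)).trans_lt h
    · rw [pow_succ y, ← sub_mul, norm_mul]
      exact (mul_le_of_le_one_right (norm_nonneg _) hy).trans_lt ih

theorem norm_sum_lt {ι : Type*} {s : Finset ι} {f : ι → M} {C : ℝ} (hC : 0 < C)
    (h : ∀ i ∈ s, ‖f i‖ < C) : ‖∑ i ∈ s, f i‖ < C := by
  rcases s.eq_empty_or_nonempty with rfl | hs
  · simpa using hC
  · obtain ⟨i, hi, hle⟩ := IsUltrametricDist.exists_norm_finsetSum_le_of_nonempty hs f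
    exact hle.trans_lt (h i hi)

/-- Distinct `m`-th roots of unity are not congruent when `m` is a unit. -/
theorem eq_one_of_pow_eq_one_of_norm_sub_lt {u : M} {m : ℕ} (hm : ‖(m : M)‖ = 1)
    (hu : u ^ m = 1) (h : ‖u - 1‖ < 1) : u = 1 := by
  by_contra hne
  have hm0 : m ≠ 0 := by rintro rfl; simp at hm
  have hu1 : ‖u‖ = 1 := by
    have : ‖u‖ ^ m = 1 := by rw [← norm_pow, hu, norm_one]
    exact (pow_eq_one_iff_of_nonneg (norm_nonneg _) hm0).mp this
  have hsum : ∑ i ∈ Finset.range m, u ^ i = 0 := by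
    have := geom_sum_mul u m
    rw [hu, sub_self] at this
    exact (mul_eq_zero.mp this).resolve_right (sub_ne_zero.mpr hne)
  -- Every term of the vanishing geometric sum is congruent to 1, so 0 ≡ `m`, which is a unit.
  have hlt : ‖∑ i ∈ Finset.range m, (u ^ i - 1)‖ < 1 :=
    norm_sum_lt one_pos fun i _ => by
      simpa using norm_pow_sub_pow_lt_one hu1.le norm_one.le h i
  rw [Finset.sum_sub_distrib, hsum] at hlt
  simp [hm] at hlt

end Ultrametric

/-! ### Tame isometric automorphisms -/

section Galois

/-- Applying `σ` shifts the orbit cyclically; only `x`, not all of `M`, need be fixed by `σ ^ m`. -/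
theorem apply_sum_pow_apply {k M : Type*} [Field k] [Field M] [Algebra k M]
    {σ : M ≃ₐ[k] M} {x : M} {m : ℕ} (h : (σ ^ m) x = x) :
    σ (∑ i ∈ Finset.range m, (σ ^ i) x) = ∑ i ∈ Finset.range m, (σ ^ i) x := by
  have h1 := Finset.sum_range_succ (fun i => (σ ^ i) x) m
  rw [Finset.sum_range_succ'] at h1
  simp only [h, pow_zero, AlgEquiv.one_apply] at h1
  rw [map_sum]
  simpa only [pow_succ', AlgEquiv.mul_apply] using add_right_cancel h1

variable {k M : Type*} [Field k] [NormedField M] [IsUltrametricDist M] [Algebra k M]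

theorem norm_pow_apply_sub_lt {σ : M ≃ₐ[k] M} (hσ : ∀ x, ‖σ x‖ = ‖x‖) {x : M} {C : ℝ}
    (h : ‖σ x - x‖ < C) (i : ℕ) : ‖(σ ^ i) x - x‖ < C := by
  induction i with
  | zero => simpa using (norm_nonneg _).trans_lt h
  | succ i ih =>
    refine norm_sub_lt_of_norm_sub_lt (y := σ x) ?_ h
    rwa [pow_succ', AlgEquiv.mul_apply, ← map_sub, hσ]

/-- An automorphism of order prime to the residue characteristic moves some element by its full
norm. -/
theorem exists_norm_le_norm_apply_sub {σ : M ≃ₐ[k] M} (hσ : ∀ x, ‖σ x‖ = ‖x‖) {m : ℕ}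
    (hm : ‖(m : M)‖ = 1) {x : M} (hx : (σ ^ m) x = x) (hne : σ x ≠ x) :
    let y := x - (m : M)⁻¹ * ∑ i ∈ Finset.range m, (σ ^ i) x
    y ≠ 0 ∧ ‖y‖ ≤ ‖σ y - y‖ := by
  intro y
  set S := ∑ i ∈ Finset.range m, (σ ^ i) x with hS
  have hm0 : (m : M) ≠ 0 := by rw [← norm_ne_zero_iff, hm]; exact one_ne_zero
  have hSσ : σ ((m : M)⁻¹ * S) = (m : M)⁻¹ * S := by
    rw [map_mul, map_inv₀, map_natCast, apply_sum_pow_apply hx]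
  have hSσi (i : ℕ) : (σ ^ i) ((m : M)⁻¹ * S) = (m : M)⁻¹ * S := by
    induction i with
    | zero => simp
    | succ i ih => rw [pow_succ, AlgEquiv.mul_apply, hSσ, ih]
  have hy0 : y ≠ 0 := by
    intro h0
    have : x = (m : M)⁻¹ * S := sub_eq_zero.mp h0
    exact hne (by rw [this, hSσ])
  refine ⟨hy0, ?_⟩
  -- Otherwise the trace of `y`, which is 0, would differ from `m * y` by less than `‖y‖ = ‖m * y‖`.
  by_contra! hlt
  have hyS : y = x - (m : M)⁻¹ * S := rfl
  have hsum : ∑ i ∈ Finset.range m, (σ ^ i) y = 0 := by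
    simp only [hyS, map_sub, hSσi, Finset.sum_sub_distrib, Finset.sum_const, Finset.card_range,
      nsmul_eq_mul, mul_inv_cancel_left₀ hm0]
    rw [hS, sub_self]
  have := norm_sum_lt (s := Finset.range m) (norm_pos_iff.mpr hy0) fun i _ =>
    norm_pow_apply_sub_lt hσ hlt i
  rw [Finset.sum_sub_distrib, hsum] at this
  simp [hm] at this

/-- If `τ` acts trivially on residues and generates, modulo a normal subgroup `H`, a cyclic group of
order `p ^ (s + 1)` prime to the residue characteristic, then the fixed field contains an integral
element of exact order `p ^ (s + 1)` modulo the maximal ideal. -/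
theorem exists_fixed_residue_root_of_unity {p s : ℕ} (hp : ‖(p : M)‖ = 1)
    (hiso : ∀ (σ : M ≃ₐ[k] M) (x : M), ‖σ x‖ = ‖x‖) (H : Subgroup (M ≃ₐ[k] M)) [H.Normal]
    {τ : M ≃ₐ[k] M} (hτ : ∀ x, ‖x‖ ≤ 1 → ‖τ x - x‖ < 1)
    (hgen : ∀ g, ∃ j : ℕ, ∃ h ∈ H, g = τ ^ j * h) (hpow : τ ^ p ^ (s + 1) ∈ H)
    {x : M} (hxH : ∀ h ∈ H, h x = x) (hx : (τ ^ p ^ s) x ≠ x) :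
    ∃ c : M, (∀ g : M ≃ₐ[k] M, g c = c) ∧ ‖c‖ ≤ 1 ∧ ‖c ^ p ^ (s + 1) - 1‖ < 1 ∧
      1 ≤ ‖c ^ p ^ s - 1‖ := by
  have hp0 : (p : M) ≠ 0 := by rw [← norm_ne_zero_iff, hp]; exact one_ne_zero
  have hfix (g : M ≃ₐ[k] M) {z : M} (hz : ∀ h ∈ H, h z = z) : ∀ h ∈ H, h (g z) = g z := by
    intro h hh
    have := hz (g⁻¹ * h * g) (by simpa using ‹H.Normal›.conj_mem h hh g⁻¹)
    rw [AlgEquiv.mul_apply, AlgEquiv.mul_apply] at this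
    simpa [← AlgEquiv.mul_apply] using congrArg g this
  obtain ⟨hy0, hy⟩ := exists_norm_le_norm_apply_sub (σ := τ ^ p ^ s) (hiso _) hp
    (by rw [← pow_mul, ← pow_succ]; exact hxH _ hpow) hx
  set y := x - (p : M)⁻¹ * ∑ i ∈ Finset.range p, ((τ ^ p ^ s) ^ i) x with hydef
  have hyH : ∀ h ∈ H, h y = y := by
    intro h hh
    simp only [hydef, map_sub, map_mul, map_inv₀, map_natCast, map_sum, hxH h hh]
    congr 2
    exact Finset.sum_congr rfl fun i _ => hfix _ hxH h hh
  -- The tame cocycle: multiplicative in powers of `τ` up to congruence, as `τ` fixes the residue of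
  -- a unit.
  set b := τ y / y with hb
  have hyn : ‖y‖ ≠ 0 := norm_ne_zero_iff.mpr hy0
  have hb1 : ‖b‖ = 1 := by rw [hb, norm_div, hiso, div_self hyn]
  have hbH : ∀ h ∈ H, h b = b := fun h hh => by
    rw [hb, map_div₀, hfix τ hyH h hh, hyH h hh]
  have hcocycle (j : ℕ) : ‖(τ ^ j) y / y - b ^ j‖ < 1 := by
    induction j with
    | zero => simp [div_self hy0]
    | succ j ih =>
      refine norm_sub_lt_of_norm_sub_lt (y := (τ ^ j) y / y * b) ?_ ?_
      · have : (τ ^ (j + 1)) y / y = τ ((τ ^ j) y / y) * b := by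
          rw [map_div₀, ← AlgEquiv.mul_apply, ← pow_succ', hb]
          have : τ y ≠ 0 := by simpa using hy0
          field_simp
        rw [this, ← sub_mul, norm_mul, hb1, mul_one]
        exact hτ _ (by rw [norm_div, hiso, div_self hyn])
      · rwa [pow_succ b, ← sub_mul, norm_mul, hb1, mul_one]
  set m := p ^ (s + 1) with hm
  have hmn : ‖(m : M)‖ = 1 := by rw [hm, Nat.cast_pow, norm_pow, hp, one_pow]
  have hm0 : (m : M) ≠ 0 := by rw [← norm_ne_zero_iff, hmn]; exact one_ne_zero
  -- Averaging makes `b` invariant without changing its residue.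
  set c := (m : M)⁻¹ * ∑ i ∈ Finset.range m, (τ ^ i) b with hc
  have hcb : ‖c - b‖ < 1 := by
    have : c - b = (m : M)⁻¹ * ∑ i ∈ Finset.range m, ((τ ^ i) b - b) := by
      rw [Finset.sum_sub_distrib, mul_sub, Finset.sum_const, Finset.card_range, nsmul_eq_mul,
        inv_mul_cancel_left₀ hm0]
    rw [this, norm_mul, norm_inv, hmn, inv_one, one_mul]
    exact norm_sum_lt one_pos fun i _ => norm_pow_apply_sub_lt (hiso τ) (hτ b hb1.le) i
  have hc1 : ‖c‖ ≤ 1 := by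
    rw [← sub_add_cancel c b]
    exact (IsUltrametricDist.norm_add_le_max _ _).trans (max_le hcb.le hb1.le)
  have hcτ : τ c = c := by
    rw [hc, map_mul, map_inv₀, map_natCast, apply_sum_pow_apply (hbH _ hpow)]
  have hcτj (j : ℕ) : (τ ^ j) c = c := by
    induction j with
    | zero => simp
    | succ j ih => rw [pow_succ, AlgEquiv.mul_apply, hcτ, ih]
  have hcH : ∀ h ∈ H, h c = c := by
    intro h hh
    simp only [hc, map_mul, map_inv₀, map_natCast, map_sum]
    congr 1
    exact Finset.sum_congr rfl fun i _ => hfix _ hbH h hh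
  refine ⟨c, fun g => ?_, hc1, ?_, ?_⟩
  · obtain ⟨j, h, hh, rfl⟩ := hgen g
    rw [AlgEquiv.mul_apply, hcH h hh, hcτj]
  · refine norm_sub_lt_of_norm_sub_lt (norm_pow_sub_pow_lt_one hc1 hb1.le hcb m) ?_
    have := hcocycle m
    rwa [hyH _ hpow, div_self hy0, norm_sub_rev] at this
  -- A smaller order would make `τ ^ p ^ s` move `y` by less than `‖y‖`.
  · by_contra! hlt
    have h1 := norm_sub_lt_of_norm_sub_lt (hcocycle (p ^ s)) (norm_sub_lt_of_norm_sub_lt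
      (norm_pow_sub_pow_lt_one hb1.le hc1 (by rwa [norm_sub_rev]) (p ^ s)) hlt)
    rw [div_sub_one hy0, norm_div, div_lt_one (norm_pos_iff.mpr hy0)] at h1
    exact hy.not_gt h1

end Galois

/-! ### Complete ultrametric base fields -/

section Complete

variable {k : Type*} [NontriviallyNormedField k] [IsUltrametricDist k] [CompleteSpace k]

/-- Lifting of roots of unity of order prime to the residue characteristic. -/
theorem exists_pow_eq_one_norm_sub_lt [CharZero k] {m : ℕ} (hm : ‖(m : k)‖ = 1) {c : k}
    (h : ‖c ^ m - 1‖ < 1) : ∃ ζ : k, ζ ^ m = 1 ∧ ‖c - ζ‖ < 1 := by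
  let Ω := AlgebraicClosure k
  let _ : NormedField Ω := spectralNorm.normedField k Ω
  have : IsUltrametricDist Ω :=
    IsUltrametricDist.isUltrametricDist_of_isNonarchimedean_norm isNonarchimedean_spectralNorm
  have hext (x : k) : ‖algebraMap k Ω x‖ = ‖x‖ := spectralNorm_extends x
  have hiso (σ : Ω ≃ₐ[k] Ω) (x : Ω) : ‖σ x‖ = ‖x‖ := (spectralNorm_eq_of_equiv σ x).symm
  have hm0 : m ≠ 0 := by rintro rfl; simp at hm
  have hmΩ : ‖(m : Ω)‖ = 1 := by rw [← map_natCast (algebraMap k Ω), hext, hm]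
  have : NeZero (m : Ω) := ⟨by rw [← norm_ne_zero_iff, hmΩ]; exact one_ne_zero⟩
  have : NeZero m := ⟨hm0⟩
  obtain ⟨ξ, hξ⟩ := HasEnoughRootsOfUnity.exists_primitiveRoot Ω m
  have hprod := congrArg (Polynomial.eval (algebraMap k Ω c))
    (Polynomial.X_pow_sub_one_eq_prod (Nat.pos_of_ne_zero hm0) hξ)
  simp only [Polynomial.eval_sub, Polynomial.eval_pow, Polynomial.eval_X, Polynomial.eval_one,
    Polynomial.eval_prod, Polynomial.eval_C] at hprod
  obtain ⟨z, hz, hcz⟩ : ∃ z ∈ Polynomial.nthRootsFinset m (1 : Ω), ‖algebraMap k Ω c - z‖ < 1 := by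
    by_contra! hall
    have := congrArg norm hprod
    rw [norm_prod, ← map_pow, ← map_one (algebraMap k Ω), ← map_sub, hext] at this
    rw [this] at h
    exact h.not_ge (Finset.one_le_prod fun z hz => hall z (by simpa using hz))
  rw [Polynomial.mem_nthRootsFinset (Nat.pos_of_ne_zero hm0)] at hz
  have hz0 : z ≠ 0 := by rintro rfl; simp [hm0] at hz
  have hz1 : ‖z‖ = 1 := by
    have : ‖z‖ ^ m = 1 := by rw [← norm_pow, hz, norm_one]
    exact (pow_eq_one_iff_of_nonneg (norm_nonneg _) hm0).mp this
  -- As in Krasner's lemma: every conjugate of `z` is also congruent to `c`, hence to `z`, hence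
  -- equal to `z`.
  obtain ⟨ζ, rfl⟩ : z ∈ Set.range (algebraMap k Ω) := by
    rw [InfiniteGalois.mem_range_algebraMap_iff_fixed]
    intro σ
    have hlt : ‖σ z - z‖ < 1 := by
      refine norm_sub_lt_of_norm_sub_lt (y := algebraMap k Ω c) ?_ hcz
      rw [← AlgEquiv.commutes σ c, ← map_sub, hiso, norm_sub_rev]
      exact hcz
    have := eq_one_of_pow_eq_one_of_norm_sub_lt (u := σ z / z) hmΩ
      (by rw [div_pow, ← map_pow, hz, map_one, div_one])
      (by rwa [div_sub_one hz0, norm_div, hz1, div_one])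
    exact (div_eq_one_iff_eq hz0).mp this
  refine ⟨ζ, (algebraMap k Ω).injective (by simpa using hz), ?_⟩
  rwa [← map_sub, hext] at hcz

variable {M : Type*} [Field M] [Algebra k M] [Algebra.IsAlgebraic k M]

/-- Elements of norm at most 1 are integral over `A`; a difference of norm at least 1 would have an
integral inverse, hence be a unit in the Jacobson radical. -/
theorem spectralNorm_sub_lt_one_of_mem_inertia {A : ValuationSubring k}
    (hA : ∀ x, ‖x‖ ≤ 1 → x ∈ A) {τ : M ≃ₐ[k] M} (hτ : τ ∈ inertia A M) {x : M}
    (hx : spectralNorm k M x ≤ 1) : spectralNorm k M (τ x - x) < 1 := by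
  have hmem {y : M} (hy : spectralNorm k M y ≤ 1) : y ∈ integralClosure A M := by
    have hint : IsIntegral k y := Algebra.IsIntegral.isIntegral y
    have hcoeff := (spectralValue_le_one_iff (minpoly.monic hint)).mp hy
    have hlift : minpoly k y ∈ Polynomial.lifts (algebraMap A k) :=
      (Polynomial.lifts_iff_coeff_lifts _).mpr fun n => ⟨⟨_, hA _ (hcoeff n)⟩, rfl⟩
    obtain ⟨P, hP, -, hPm⟩ := Polynomial.lifts_and_degree_eq_and_monic hlift (minpoly.monic hint)
    refine ⟨P, hPm, ?_⟩
    rw [IsScalarTower.algebraMap_eq A k M, ← Polynomial.eval₂_map, hP]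
    exact minpoly.aeval k y
  have hmul (a b : M) : spectralNorm k M (a * b) = spectralNorm k M a * spectralNorm k M b :=
    map_mul (spectralMulAlgNorm k M) a b
  by_contra! hge
  set z := τ x - x with hz
  have hzmem : (τ • (⟨x, hmem hx⟩ : integralClosure A M) - ⟨x, hmem hx⟩ : integralClosure A M) ∈
      Ring.jacobson (integralClosure A M) := hτ ⟨x, hmem hx⟩
  have hz0 : z ≠ 0 := by
    intro h0
    rw [h0, spectralNorm_zero] at hge
    exact hge.not_gt one_pos
  have hinv : spectralNorm k M z⁻¹ ≤ 1 := by
    have h1 := hmul z z⁻¹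
    rw [mul_inv_cancel₀ hz0, spectralNorm_one] at h1
    nlinarith [spectralNorm_nonneg (K := k) (L := M) z⁻¹]
  have hone : (1 : integralClosure A M) ∈ Ring.jacobson (integralClosure A M) := by
    convert Ideal.mul_mem_left _ ⟨z⁻¹, hmem hinv⟩ hzmem
    exact Subtype.ext (inv_mul_cancel₀ hz0).symm
  exact (Ring.jacobson_lt_top (R := integralClosure A M)).ne ((Ideal.eq_top_iff_one _).mpr hone)

/-- If a continuous character to `ℤ / p ^ (s + 1)` takes a unit value on some inertia element, then
the base field contains a primitive `p ^ (s + 1)`-th root of unity. -/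
theorem exists_isPrimitiveRoot_of_character [CharZero k] [IsGalois k M] {p : ℕ} [Fact p.Prime]
    {s : ℕ} (hp : ‖(p : k)‖ = 1) {A : ValuationSubring k} (hA : ∀ x, ‖x‖ ≤ 1 → x ∈ A)
    (χ : (M ≃ₐ[k] M) →* Multiplicative (ZMod (p ^ (s + 1)))) (hχ : Continuous χ)
    {τ : M ≃ₐ[k] M} (hτ : τ ∈ inertia A M) (hu : IsUnit (χ τ).toAdd) :
    ∃ ζ : k, IsPrimitiveRoot ζ (p ^ (s + 1)) := by
  let _ : NormedField M := spectralNorm.normedField k M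
  have : IsUltrametricDist M :=
    IsUltrametricDist.isUltrametricDist_of_isNonarchimedean_norm isNonarchimedean_spectralNorm
  have hext (x : k) : ‖algebraMap k M x‖ = ‖x‖ := spectralNorm_extends x
  have hpM : ‖(p : M)‖ = 1 := by rw [← map_natCast (algebraMap k M), hext, hp]
  have : NeZero (p ^ (s + 1)) := ⟨pow_ne_zero _ (Fact.out : p.Prime).ne_zero⟩
  let H : ClosedSubgroup (M ≃ₐ[k] M) := ⟨χ.ker, (isClosed_singleton (x := 1)).preimage hχ⟩
  have hmemH (g : M ≃ₐ[k] M) : g ∈ χ.ker ↔ (χ g).toAdd = 0 := Iff.rfl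
  have hpow (j : ℕ) : (χ (τ ^ j)).toAdd = j * (χ τ).toAdd := by
    rw [map_pow, toAdd_pow, nsmul_eq_mul]
  have hgen (g : M ≃ₐ[k] M) : ∃ j : ℕ, ∃ h ∈ χ.ker, g = τ ^ j * h := by
    obtain ⟨u, hu⟩ := hu
    refine ⟨((χ g).toAdd * (u⁻¹ : (ZMod (p ^ (s + 1)))ˣ)).val, (τ ^ _)⁻¹ * g, ?_,
      (mul_inv_cancel_left _ _).symm⟩
    rw [hmemH, map_mul, map_inv, toAdd_mul, toAdd_inv, hpow, ZMod.natCast_zmod_val, ← hu]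
    simp
  have hs1 : τ ^ p ^ (s + 1) ∈ χ.ker := by
    rw [hmemH, hpow, ZMod.natCast_self, zero_mul]
  have hs : τ ^ p ^ s ∉ χ.ker := by
    rw [hmemH, hpow, hu.mul_left_eq_zero, ZMod.natCast_eq_zero_iff,
      Nat.pow_dvd_pow_iff_le_right (Fact.out : p.Prime).one_lt]
    omega
  -- Infinite Galois correspondence: `χ.ker` is closed because `χ` is continuous.
  obtain ⟨x, hxH, hx⟩ : ∃ x : M, (∀ h ∈ χ.ker, h x = x) ∧ (τ ^ p ^ s) x ≠ x := by
    by_contra! hall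
    refine hs ?_
    have h1 := InfiniteGalois.fixingSubgroup_fixedField H
    change _ = χ.ker at h1
    rw [← h1, IntermediateField.mem_fixingSubgroup_iff]
    intro x hx
    exact hall x fun h hh => (IntermediateField.mem_fixedField_iff _ _).mp hx h hh
  obtain ⟨c, hcfix, hcn, hc1, hc2⟩ := exists_fixed_residue_root_of_unity hpM
    (fun σ x => (spectralNorm_eq_of_equiv σ x).symm) χ.ker
    (fun x hx => spectralNorm_sub_lt_one_of_mem_inertia hA hτ hx) hgen hs1 hxH hx
  obtain ⟨c, rfl⟩ := (InfiniteGalois.mem_range_algebraMap_iff_fixed c).mpr hcfix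
  rw [← map_pow, ← map_one (algebraMap k M), ← map_sub, hext] at hc1 hc2
  rw [hext] at hcn
  obtain ⟨ζ, hζ, hcζ⟩ := exists_pow_eq_one_norm_sub_lt
    (by rw [Nat.cast_pow, norm_pow, hp, one_pow]) hc1
  have hζ1 : ‖ζ‖ = 1 := by
    have : ‖ζ‖ ^ p ^ (s + 1) = 1 := by rw [← norm_pow, hζ, norm_one]
    exact (pow_eq_one_iff_of_nonneg (norm_nonneg _) (NeZero.ne _)).mp this
  refine ⟨ζ, ?_⟩
  rw [← orderOf_eq_prime_pow (x := ζ) (n := s) (p := p) ?_ hζ]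
  · exact IsPrimitiveRoot.orderOf ζ
  · intro h
    refine hc2.not_gt ?_
    rw [← h]
    exact norm_pow_sub_pow_lt_one hcn hζ1.le hcζ _

end Complete

/-! ### The pro-p extension and the near-diagonal character -/

instance maximalProP_normal (p : ℕ) (k : Type*) [Field k] : Normal k (maximalProP p k) := by
  rw [maximalProP, sSup_eq_iSup']
  have (L : {L : IntermediateField k (AlgebraicClosure k) |
      FiniteDimensional k L ∧ IsGalois k L ∧ IsPGroup p (L ≃ₐ[k] L)}) :
      Normal k (L : IntermediateField k (AlgebraicClosure k)) := by
    have := L.2.2.1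
    infer_instance
  exact IntermediateField.normal_iSup k (AlgebraicClosure k) _

instance maximalProP_isGalois (p : ℕ) (k : Type*) [Field k] [CharZero k] :
    IsGalois k (maximalProP p k) where

theorem continuous_nearDiagonal {n : ℕ} {R : Type*} [CommRing R] [TopologicalSpace R] (i : Fin n) :
    Continuous (nearDiagonal n R i) :=
  continuous_ofAdd.comp
    ((Units.continuous_val.comp continuous_subtype_val).matrix_elem i.castSucc i.succ)

theorem isUnit_of_castHom_ne_zero {p r : ℕ} [Fact p.Prime] (hr : r ≠ 0) {a : ZMod (p ^ r)}
    (ha : ZMod.castHom (dvd_pow_self p hr) (ZMod p) a ≠ 0) : IsUnit a := by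
  have : NeZero (p ^ r) := ⟨pow_ne_zero _ (Fact.out : p.Prime).ne_zero⟩
  rw [← ZMod.natCast_zmod_val a] at ha ⊢
  rw [map_natCast, Ne, ZMod.natCast_eq_zero_iff] at ha
  rw [ZMod.isUnit_iff_coprime]
  exact ((Nat.Prime.coprime_iff_not_dvd Fact.out).mpr ha).symm.pow_right r

/-! ### Completions of number fields -/

section NumberField

variable {K : Type*} [Field K] [NumberField K] (q : HeightOneSpectrum (𝓞 K))

instance : CharZero (q.adicCompletion K) :=
  charZero_of_injective_algebraMap (algebraMap K (q.adicCompletion K)).injective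

instance : IsUltrametricDist (q.adicCompletion K) :=
  Valued.instIsUltrametricDist _ _

theorem norm_natCast_eq_one {p : ℕ} (hp : (p : 𝓞 K) ∉ q.asIdeal) :
    ‖(p : q.adicCompletion K)‖ = 1 := by
  simpa using (FinitePlace.norm_eq_one_iff_notMem K q _).mpr hp

/-- Every integer of the completion is congruent to a global integer. -/
theorem exists_norm_algebraMap_sub_lt_one {x : q.adicCompletion K} (hx : ‖x‖ ≤ 1) :
    ∃ a : 𝓞 K, ‖FinitePlace.embedding q (algebraMap (𝓞 K) K a) - x‖ < 1 := by
  obtain ⟨y, hy⟩ := (HeightOneSpectrum.denseRange_algebraMap K q).exists_dist_lt x one_pos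
  rw [dist_comm, dist_eq_norm] at hy
  change ‖FinitePlace.embedding q y - x‖ < 1 at hy
  have hy1 : ‖FinitePlace.embedding q y‖ ≤ 1 := by
    rw [← sub_add_cancel (FinitePlace.embedding q y) x]
    exact (IsUltrametricDist.norm_add_le_max _ _).trans (max_le hy.le hx)
  have hyv : q.valuation K y ≤ 1 := by
    rw [← HeightOneSpectrum.valuedAdicCompletion_eq_valuation']
    exact Valued.toNormedField.norm_le_one_iff.mp hy1
  obtain ⟨a, ha⟩ := q.exists_valuation_sub_lt_of_integer hyv 1
  refine ⟨a, norm_sub_lt_of_norm_sub_lt ?_ hy⟩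
  rw [← map_sub]
  refine Valued.toNormedField.norm_lt_one_iff.mpr ?_
  rw [FinitePlace.embedding_apply, HeightOneSpectrum.valuedAdicCompletion_eq_valuation']
  exact ha

theorem absNorm_modEq_one_of_isPrimitiveRoot {p s : ℕ} [Fact p.Prime]
    (hp : (p : 𝓞 K) ∉ q.asIdeal) {ζ : q.adicCompletion K}
    (hζ : IsPrimitiveRoot ζ (p ^ (s + 1))) : Ideal.absNorm q.asIdeal ≡ 1 [MOD p ^ (s + 1)] := by
  have hpn : ‖(p : q.adicCompletion K)‖ = 1 := norm_natCast_eq_one q hp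
  have hζ1 : ‖ζ‖ = 1 := by
    have : ‖ζ‖ ^ p ^ (s + 1) = 1 := by rw [← norm_pow, hζ.pow_eq_one, norm_one]
    exact (pow_eq_one_iff_of_nonneg (norm_nonneg _)
      (pow_ne_zero _ (Fact.out : p.Prime).ne_zero)).mp this
  obtain ⟨a, ha⟩ := exists_norm_algebraMap_sub_lt_one q hζ1.le
  have ha1 := FinitePlace.norm_le_one K q a
  have hmem (m : ℕ) :
      a ^ m - 1 ∈ q.asIdeal ↔ ‖FinitePlace.embedding q (algebraMap (𝓞 K) K a) ^ m - 1‖ < 1 := by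
    rw [← FinitePlace.norm_lt_one_iff_mem K q]
    simp only [map_sub, map_pow, map_one]
  have hpow (m : ℕ) := norm_pow_sub_pow_lt_one ha1 hζ1.le ha m
  have hmem₁ : a ^ p ^ (s + 1) - 1 ∈ q.asIdeal := by
    rw [hmem, ← hζ.pow_eq_one]
    exact hpow _
  -- Reduction is injective on roots of unity of order prime to the residue characteristic, so the
  -- order does not drop.
  have hmem₂ : a ^ p ^ s - 1 ∉ q.asIdeal := by
    rw [hmem]
    intro h
    have h1 := norm_sub_lt_of_norm_sub_lt (by rw [norm_sub_rev]; exact hpow (p ^ s)) h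
    have h2 := eq_one_of_pow_eq_one_of_norm_sub_lt hpn
      (by rw [← pow_mul, ← pow_succ, hζ.pow_eq_one]) h1
    exact (Nat.pow_lt_pow_right (Fact.out : p.Prime).one_lt s.lt_succ_self).not_ge
      (Nat.le_of_dvd (pow_pos (Fact.out : p.Prime).pos _) (hζ.dvd_of_pow_eq_one _ h2))
  have := q.isMaximal
  let _ : Field (𝓞 K ⧸ q.asIdeal) := Ideal.Quotient.field _
  have : Finite (𝓞 K ⧸ q.asIdeal) := q.asIdeal.finiteQuotientOfFreeOfNeBot q.ne_bot
  let _ : Fintype (𝓞 K ⧸ q.asIdeal) := Fintype.ofFinite _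
  have hmk (m : ℕ) : Ideal.Quotient.mk q.asIdeal a ^ m = 1 ↔ a ^ m - 1 ∈ q.asIdeal := by
    rw [← Ideal.Quotient.eq, map_pow, map_one]
  have hord : orderOf (Ideal.Quotient.mk q.asIdeal a) = p ^ (s + 1) :=
    orderOf_eq_prime_pow (by rwa [hmk]) (by rwa [hmk])
  have h0 : Ideal.Quotient.mk q.asIdeal a ≠ 0 := by
    intro h0
    have := (hmk _).mpr hmem₁
    rw [h0, zero_pow (pow_ne_zero _ (Fact.out : p.Prime).ne_zero)] at this
    exact zero_ne_one this
  have hcard : Ideal.absNorm q.asIdeal = Fintype.card (𝓞 K ⧸ q.asIdeal) := by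
    rw [Ideal.absNorm_apply, Submodule.cardQuot_apply, Nat.card_eq_fintype_card]
  rw [hcard]
  refine ((Nat.modEq_iff_dvd' Fintype.card_pos).mpr ?_).symm
  rw [← hord]
  exact orderOf_dvd_of_pow_eq_one (FiniteField.pow_card_sub_one_eq_one _ h0)

end NumberField

end LocalLift

theorem mainTheorem6 (p : ℕ) [Fact p.Prime] (K : Type*) [Field K] [NumberField K]
    (q : IsDedekindDomain.HeightOneSpectrum (NumberField.RingOfIntegers K))
    (tame : (p : NumberField.RingOfIntegers K) ∉ q.asIdeal)
    (n r : ℕ) (hr : r ≠ 0)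
    (ρ : LocalLift.LocalGaloisGroup p K q →ₜ* LocalLift.unipotent (n + 1) (ZMod p))
    (ρr : LocalLift.LocalGaloisGroup p K q →ₜ* LocalLift.unipotent (n + 1) (ZMod (p ^ r)))
    (hlift : ∀ g, LocalLift.unipotentMap (n + 1)
      (ZMod.castHom (dvd_pow_self p hr) (ZMod p)) (ρr g) = ρ g)
    (i : Fin n)
    (hram : LocalLift.IsRamified
      ((LocalLift.nearDiagonal n (ZMod p) i).comp ρ.toMonoidHom)) :
    (∃ ζ : q.adicCompletion K, IsPrimitiveRoot ζ (p ^ r)) ∧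
      Ideal.absNorm q.asIdeal ≡ 1 [MOD p ^ r] := by
  obtain ⟨s, rfl⟩ := Nat.exists_eq_succ_of_ne_zero hr
  obtain ⟨τ, hτ, hne⟩ := hram
  let _ : NontriviallyNormedField (q.adicCompletion K) :=
    { NumberField.HeightOneSpectrum.instNormedFieldValuedAdicCompletion K q with
      non_trivial := by
        -- An element with a simple pole has norm above 1.
        obtain ⟨x, hx⟩ := HeightOneSpectrum.valuedAdicCompletion_surjective K q (WithZero.exp 1)
        refine ⟨x, Valued.toNormedField.one_lt_norm_iff.mpr ?_⟩
        rw [hx, ← WithZero.exp_zero, WithZero.exp_lt_exp]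
        exact one_pos }
  obtain ⟨ζ, hζ⟩ : ∃ ζ : q.adicCompletion K, IsPrimitiveRoot ζ (p ^ (s + 1)) := by
    refine LocalLift.exists_isPrimitiveRoot_of_character (A := q.adicCompletionIntegers K)
      (LocalLift.norm_natCast_eq_one q tame) ?_
      ((LocalLift.nearDiagonal n (ZMod (p ^ (s + 1))) i).comp ρr.toMonoidHom)
      ((LocalLift.continuous_nearDiagonal i).comp ρr.continuous_toFun) hτ ?_
    · exact fun x hx => Valued.toNormedField.norm_le_one_iff.mp hx
    · refine LocalLift.isUnit_of_castHom_ne_zero hr fun h0 => hne ?_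
      rw [MonoidHom.comp_apply]
      change LocalLift.nearDiagonal n (ZMod p) i (ρ τ) = 1
      rw [← hlift]
      exact congrArg Multiplicative.ofAdd h0
  exact ⟨⟨ζ, hζ⟩, LocalLift.absNorm_modEq_one_of_isPrimitiveRoot q tame hζ⟩
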